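/- Call a function $R(s,t)$ of $s,t\ge 0$ *admissible* if every zero-mean real Gaussian process $(G_t)_{t\ge 0}$ with covariance function $\mathbb E(G_sG_t)=R(s,t)$ satisfies 1. there are constants $c$ and $\beta\in(0,2)$ with $\mathbb E(G_t^2)\le c\,t^\beta$ for all $t\ge 0$; 2. for all $n$ and all times $0<t_1<\dots<t_n$ the covariance matrix $(\mathbb E(G_{t_i}G_{t_j}))_{i,j\le n}$ is strictly positive definite; and if, moreover, the explicit matrices $(R(t_i,t_j))_{i,j\le n}$ are themselves strictly positive definite for all $0<t_1<\dots<t_n$ (so that admissibility does not hold merely for lack of such a process). **Theorem.** Each of the following functions is admissible, for all parameters in the stated ranges. 1. ($X^K(t^{2H})$ for the Lei–Nualart process $X^K$.) For $H\in(0,1)$ and $HK\in(0,1)$, $$R(t,s)=\begin{cases}\frac{\Gamma(1-K)}{K(2-K)}\left[t^{2HK}+s^{2HK}-(t^{2H}+s^{2H})^{K}\right], & K\in(0,1),\\[2pt] \frac{\Gamma(2-K)}{K(K-1)}\left[(t^{2H}+s^{2H})^{K}-t^{2HK}-s^{2HK}\right], & K\in(1,2),\end{cases}$$ and likewise, for $K\in(0,1)$,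 with the factor $\frac{\Gamma(1-K)}{K(2-K)}$ replaced by $\frac{\Gamma(1-K)}{K}$, which is the normalization of $X^K(t)=\int_0^\infty(1-e^{-\theta t})\theta^{-(1+K)/2}\,dW_\theta$ with $W$ a Brownian motion. 2. (Fractional Brownian motion.) $R(s,t)=\frac12\left(s^{2H}+t^{2H}-|t-s|^{2H}\right)$, $H\in(0,1)$. 3. $R(s,t)=(t+s)^{2H}-|t-s|^{2H}$, $H\in(0,1)$. 4. (Sub-fractional Brownian motion.) $R(t,s)=s^{2H}+t^{2H}-\frac12\left((s+t)^{2H}+|t-s|^{2H}\right)$, $H\in(0,1)$. 5. $R(s,t)=(s+t)^{2H}-(\max(s,t))^{2H}$, $H\in(0,\frac12)$. 6. $R(s,t)=(\max(s,t))^{2H}-|t-s|^{2H}$, $H\in(0,\frac12)$. 7. $R(t,s)=\frac12\left[t^{2H}+s^{2H}-K(t+s)^{2H}-(1-K)|t-s|^{2H}\right]$, $H\in(0,\frac12)$, $K\in(0,1)$. 8. (Bifractional Brownian motion.) $R(t,s)=\frac1{2^K}\left((s^{2H}+t^{2H})^K-|t-s|^{2HK}\right)$, $H\in(0,1)$, $K\in(0,1)\cup(1,2)$,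 $HK\in(0,1)$. 9. (Sub-bifractional Brownian motion for $K\in(0,1)$, generalized sub-fractional Brownian motion for $K\in(1,2)$.) $R(t,s)=(s^{2H}+t^{2H})^{K}-\frac12\left[(t+s)^{2HK}+|t-s|^{2HK}\right]$, $H\in(0,1)$, $K\in(0,1)\cup(1,2)$, $HK\in(0,1)$. -/

import Mathlib

open MeasureTheory ProbabilityTheory
open scoped NNReal

universe u

noncomputable section

/-! ### Zero-mean Gaussian processes and the two hypotheses -/

/-- `G = (G_t)_{t ≥ 0}` is a zero-mean real Gaussian process on `(Ω, P)` with covariance function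
`R` on `[0, ∞) × [0, ∞)`. (A Gaussian process in Mathlib's sense has `P` a probability measure, and
all its one-dimensional marginals are square integrable, so the integrals below are genuine.) -/
structure IsCenteredGaussianWithCov {Ω : Type*} [MeasurableSpace Ω] (G : ℝ≥0 → Ω → ℝ)
    (P : Measure Ω) (R : ℝ → ℝ → ℝ) : Prop where
  gaussian : IsGaussianProcess G P
  mean_zero : ∀ t, ∫ ω, G t ω ∂P = 0
  cov : ∀ s t, ∫ ω, G s ω * G t ω ∂P = R s t

/-- First hypothesis: there are `c` and `β ∈ (0, 2)` with `E(G_t ^ 2) ≤ c t ^ β` for all `t ≥ 0`. -/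
def SecondMomentGrowth {Ω : Type*} [MeasurableSpace Ω] (G : ℝ≥0 → Ω → ℝ) (P : Measure Ω) : Prop :=
  ∃ c β : ℝ, 0 < β ∧ β < 2 ∧
    ∀ t : ℝ≥0, Integrable (fun ω ↦ G t ω ^ 2) P ∧ ∫ ω, G t ω ^ 2 ∂P ≤ c * (t : ℝ) ^ β

/-- Second hypothesis: for all times `0 < t_1 < ... < t_n` the covariance matrix
`(E(G_{t_i} G_{t_j}))` is strictly positive definite. -/
def StrictlyPosDefCov {Ω : Type*} [MeasurableSpace Ω] (G : ℝ≥0 → Ω → ℝ) (P : Measure Ω) : Prop :=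
  ∀ (n : ℕ) (t : Fin n → ℝ≥0), (∀ i, 0 < t i) → StrictMono t →
    (Matrix.of fun i j ↦ ∫ ω, G (t i) ω * G (t j) ω ∂P).PosDef

/-- The explicit function `R` itself has strictly positive definite matrices `(R(t_i, t_j))` for all
times `0 < t_1 < ... < t_n`. -/
def StrictlyPosDefKernel (R : ℝ → ℝ → ℝ) : Prop :=
  ∀ (n : ℕ) (t : Fin n → ℝ), (∀ i, 0 < t i) → StrictMono t →
    (Matrix.of fun i j ↦ R (t i) (t j)).PosDef

/-- The matrices of `R` are strictly positive definite, and every zero-mean Gaussian process with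
covariance function `R` satisfies both hypotheses. The first conjunct, about `R` alone, ensures that
the second one does not hold merely for lack of a process with covariance `R`. -/
def CovarianceSatisfiesHypotheses (R : ℝ → ℝ → ℝ) : Prop :=
  StrictlyPosDefKernel R ∧
    ∀ (Ω : Type u) [MeasurableSpace Ω] (P : Measure Ω) (G : ℝ≥0 → Ω → ℝ),
      IsCenteredGaussianWithCov G P R → SecondMomentGrowth G P ∧ StrictlyPosDefCov G P

/-! ### The covariance functions (used for `s, t ≥ 0`) -/

/-- The process `X^K(t^{2H})`, up to normalization when `K < 1` (see `leiNualartCov'`). -/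
def leiNualartCov (H K t s : ℝ) : ℝ :=
  if K < 1 then
    Real.Gamma (1 - K) / (K * (2 - K)) *
      (t ^ (2 * H * K) + s ^ (2 * H * K) - (t ^ (2 * H) + s ^ (2 * H)) ^ K)
  else
    Real.Gamma (2 - K) / (K * (K - 1)) *
      ((t ^ (2 * H) + s ^ (2 * H)) ^ K - t ^ (2 * H * K) - s ^ (2 * H * K))

/-- The covariance of `X^K(t^{2H})`, `X^K(t) = ∫ (1 - e^{-θt}) θ^{-(1+K)/2} dW_θ`, for
`K ∈ (0, 1)`. -/
def leiNualartCov' (H K t s : ℝ) : ℝ :=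
  Real.Gamma (1 - K) / K *
    (t ^ (2 * H * K) + s ^ (2 * H * K) - (t ^ (2 * H) + s ^ (2 * H)) ^ K)

/-- Fractional Brownian motion. -/
def fbmCov (H s t : ℝ) : ℝ :=
  1 / 2 * (s ^ (2 * H) + t ^ (2 * H) - |t - s| ^ (2 * H))

/-- The process `B(t) - B(-t)` for a two-sided fractional Brownian motion `B`. -/
def oddFbmCov (H s t : ℝ) : ℝ :=
  (t + s) ^ (2 * H) - |t - s| ^ (2 * H)

/-- Sub-fractional Brownian motion. -/
def subFbmCov (H t s : ℝ) : ℝ :=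
  s ^ (2 * H) + t ^ (2 * H) - 1 / 2 * ((s + t) ^ (2 * H) + |t - s| ^ (2 * H))

def sumMaxCov (H s t : ℝ) : ℝ :=
  (s + t) ^ (2 * H) - (max s t) ^ (2 * H)

def maxDiffCov (H s t : ℝ) : ℝ :=
  (max s t) ^ (2 * H) - |t - s| ^ (2 * H)

/-- The process `√(1-K) B^H + √(HK / Γ(1-2H)) X^{2H}`. -/
def mixedCov (H K t s : ℝ) : ℝ :=
  1 / 2 * (t ^ (2 * H) + s ^ (2 * H) - K * (t + s) ^ (2 * H) - (1 - K) * |t - s| ^ (2 * H))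

/-- Bifractional Brownian motion. -/
def bifbmCov (H K t s : ℝ) : ℝ :=
  1 / 2 ^ K * ((s ^ (2 * H) + t ^ (2 * H)) ^ K - |t - s| ^ (2 * H * K))

/-- Sub-bifractional (`K < 1`) and generalized sub-fractional (`K > 1`) Brownian motion. -/
def subBifbmCov (H K t s : ℝ) : ℝ :=
  (s ^ (2 * H) + t ^ (2 * H)) ^ K -
    1 / 2 * ((t + s) ^ (2 * H * K) + |t - s| ^ (2 * H * K))

end

/-!
Everything reduces to the strict positive definiteness of the kernels: the process enters only
through its covariance, and self-similarity makes `R t t` a multiple of `t ^ β` with `β = 2H` or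
`β = 2HK`.

Powers have the integral representation `c * x ^ α = ∫ Φ (x θ) θ ^ (-1 - α) dθ` over `(0, ∞)`, with
`c > 0`, where `Φ θ` is `1 - exp (-θ)` for `0 < α < 1`, `exp (-θ) - 1 + θ` for `1 < α < 2`, and
`1 - cos θ` for `0 < α < 2` (`HasPowerIntegral`). A linear combination of powers thus becomes a
mixture over `θ` of simpler kernels, and it is strictly positive definite if those are positive
semidefinite and no nonzero vector is isotropic for all of them (`HasPowerIntegral.posDef`).

* The Lei–Nualart kernels, `oddFbmCov` and `subFbmCov` are mixtures of rank-one kernels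
  `g (s θ) * g (t θ)` with `g` equal to `1 - exp (-·)`, `sin` and `1 - cos`; strictness is the linear
  independence of the functions `g (t_i ·)`. Fractional Brownian motion is a positive combination of
  the last two, and its case `H = 1 / 2` gives the kernel `min s t`.
* `sumMaxCov` and `maxDiffCov` are mixtures of diagonal rescalings of `min (u s) (u t)` with `u`
  increasing.
* For `K < 1` the bifractional and sub-bifractional kernels are mixtures of diagonal rescalings of
  `exp A - 1` and `exp S * cosh D - 1` (entrywise), with `A`, `S`, `D` multiples of the preceding
  kernels; these are positive definite by Schur's product theorem. For `1 < K` they are sums of a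
  Lei–Nualart kernel and a fractional or sub-fractional kernel.
-/

open Set
open scoped Matrix

/-! ### Positive definite real matrices -/

theorem Matrix.star_dotProduct_mulVec_eq_sum {ι : Type*} [Fintype ι] (M : Matrix ι ι ℝ)
    (x : ι → ℝ) : star x ⬝ᵥ M *ᵥ x = ∑ i, ∑ j, x i * x j * M i j := by
  simp only [dotProduct, Matrix.mulVec, Pi.star_apply, star_trivial, Finset.mul_sum]
  exact Finset.sum_congr rfl fun i _ ↦ Finset.sum_congr rfl fun j _ ↦ by ring

theorem Matrix.PosDef.sum_pos {ι : Type*} [Fintype ι] {M : Matrix ι ι ℝ} (hM : M.PosDef)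
    {x : ι → ℝ} (hx : x ≠ 0) : 0 < ∑ i, ∑ j, x i * x j * M i j := by
  simpa only [M.star_dotProduct_mulVec_eq_sum] using hM.dotProduct_mulVec_pos hx

theorem Matrix.PosDef.of_sum_pos {ι : Type*} [Fintype ι] {M : Matrix ι ι ℝ}
    (hsymm : ∀ i j, M i j = M j i)
    (hpos : ∀ x : ι → ℝ, x ≠ 0 → 0 < ∑ i, ∑ j, x i * x j * M i j) : M.PosDef :=
  .of_dotProduct_mulVec_pos (Matrix.IsHermitian.ext fun i j ↦ by simp [hsymm i j])
    fun x hx ↦ by simpa only [M.star_dotProduct_mulVec_eq_sum] using hpos x hx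

theorem Matrix.PosSemidef.sum_nonneg {ι : Type*} [Fintype ι] {M : Matrix ι ι ℝ}
    (hM : M.PosSemidef) (x : ι → ℝ) : 0 ≤ ∑ i, ∑ j, x i * x j * M i j := by
  simpa only [M.star_dotProduct_mulVec_eq_sum] using hM.dotProduct_mulVec_nonneg x

theorem Matrix.PosSemidef.of_sum_nonneg {ι : Type*} [Fintype ι] {M : Matrix ι ι ℝ}
    (hsymm : ∀ i j, M i j = M j i)
    (hpos : ∀ x : ι → ℝ, 0 ≤ ∑ i, ∑ j, x i * x j * M i j) : M.PosSemidef :=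
  .of_dotProduct_mulVec_nonneg (Matrix.IsHermitian.ext fun i j ↦ by simp [hsymm i j])
    fun x ↦ by simpa only [M.star_dotProduct_mulVec_eq_sum] using hpos x

theorem Matrix.PosSemidef.symm_apply {ι : Type*} {M : Matrix ι ι ℝ} (hM : M.PosSemidef)
    (i j : ι) : M i j = M j i := by
  simpa using (hM.isHermitian.apply i j).symm

/-- Congruence by a positive diagonal matrix preserves positive definiteness. -/
theorem Matrix.PosDef.diagonal_congr {ι : Type*} [Fintype ι] {M : Matrix ι ι ℝ} (hM : M.PosDef)
    {d : ι → ℝ} (hd : ∀ i, 0 < d i) : (Matrix.of fun i j ↦ d i * d j * M i j).PosDef := by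
  refine .of_sum_pos (fun i j ↦ ?_) fun x hx ↦ ?_
  · simp only [Matrix.of_apply, hM.posSemidef.symm_apply i j, mul_comm (d i)]
  · have hx' : (fun i ↦ x i * d i) ≠ 0 := fun h ↦ hx <| funext fun i ↦ by
      simpa [(hd i).ne'] using congrFun h i
    have h := hM.sum_pos hx'
    simp only [Matrix.of_apply]
    refine h.trans_eq <| Finset.sum_congr rfl fun i _ ↦ Finset.sum_congr rfl fun j _ ↦ by ring

theorem Matrix.PosSemidef.map_pow {ι : Type*} [Fintype ι] {A : Matrix ι ι ℝ} (hA : A.PosSemidef)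
    (n : ℕ) : (A.map (· ^ n)).PosSemidef := by
  induction n with
  | zero =>
    convert Matrix.posSemidef_vecMulVec_self_star (fun _ : ι ↦ (1 : ℝ))
    ext i j
    simp [Matrix.vecMulVec_apply]
  | succ n ih =>
    have h : A.map (· ^ (n + 1)) = A.map (· ^ n) ⊙ A := by
      ext i j
      simp [pow_succ]
    exact h ▸ ih.hadamard hA

/-- Entrywise application of a power series with nonnegative coefficients preserves positive
semidefiniteness (Schur's product theorem). The exponents are given by a function `p`, so that
series such as that of `cosh` are covered. -/
theorem Matrix.PosSemidef.map_of_hasSum {ι : Type*} [Fintype ι] {A : Matrix ι ι ℝ}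
    (hA : A.PosSemidef) {c : ℕ → ℝ} (hc : ∀ k, 0 ≤ c k) {p : ℕ → ℕ} {f : ℝ → ℝ}
    (hf : ∀ a, HasSum (fun k ↦ c k * a ^ p k) (f a)) : (A.map f).PosSemidef := by
  refine .of_sum_nonneg (fun i j ↦ by simp [hA.symm_apply i j]) fun x ↦ ?_
  have hs : HasSum (fun k ↦ ∑ i, ∑ j, x i * x j * (c k * A i j ^ p k))
      (∑ i, ∑ j, x i * x j * f (A i j)) :=
    hasSum_sum fun i _ ↦ hasSum_sum fun j _ ↦ (hf (A i j)).mul_left _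
  refine hs.nonneg fun k ↦ ?_
  convert mul_nonneg (hc k) ((hA.map_pow (p k)).sum_nonneg x) using 1
  simp only [Finset.mul_sum, Matrix.map_apply]
  exact Finset.sum_congr rfl fun i _ ↦ Finset.sum_congr rfl fun j _ ↦ by ring

theorem Matrix.PosSemidef.map_exp {ι : Type*} [Fintype ι] {A : Matrix ι ι ℝ}
    (hA : A.PosSemidef) : (A.map Real.exp).PosSemidef :=
  hA.map_of_hasSum (c := fun k ↦ (k.factorial : ℝ)⁻¹) (p := fun k ↦ k) (fun k ↦ by positivity)
    fun a ↦ by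
      simpa [Real.exp_eq_exp_ℝ, div_eq_inv_mul] using NormedSpace.expSeries_div_hasSum_exp a

theorem Matrix.PosSemidef.map_exp_sub_one_sub_id {ι : Type*} [Fintype ι] {A : Matrix ι ι ℝ}
    (hA : A.PosSemidef) : (A.map fun a ↦ Real.exp a - 1 - a).PosSemidef :=
  hA.map_of_hasSum (c := fun k ↦ ((k + 2).factorial : ℝ)⁻¹) (p := fun k ↦ k + 2)
    (fun k ↦ by positivity) fun a ↦ by
      have h := (hasSum_nat_add_iff' 2).mpr (NormedSpace.expSeries_div_hasSum_exp a)
      simpa [Real.exp_eq_exp_ℝ, div_eq_inv_mul, Finset.sum_range_succ, sub_sub] using h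

theorem Matrix.PosSemidef.map_cosh_sub_one {ι : Type*} [Fintype ι] {A : Matrix ι ι ℝ}
    (hA : A.PosSemidef) : (A.map fun a ↦ Real.cosh a - 1).PosSemidef :=
  hA.map_of_hasSum (c := fun k ↦ ((2 * (k + 1)).factorial : ℝ)⁻¹) (p := fun k ↦ 2 * (k + 1))
    (fun k ↦ by positivity) fun a ↦ by
      have h := (hasSum_nat_add_iff' 1).mpr (Real.hasSum_cosh a)
      simpa [div_eq_inv_mul] using h

/-- The entrywise function `exp - 1` preserves strict positive definiteness, because it dominates
the identity up to a positive semidefinite matrix. -/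
theorem Matrix.PosDef.map_exp_sub_one {ι : Type*} [Fintype ι] {A : Matrix ι ι ℝ}
    (hA : A.PosDef) : (A.map fun a ↦ Real.exp a - 1).PosDef := by
  convert hA.add_posSemidef hA.posSemidef.map_exp_sub_one_sub_id
  ext i j
  simp

/-! ### Linear independence of scaled sines and exponentials -/

/-- Sines of distinct positive frequencies are eigenfunctions of the operator
`f ↦ f (· + δ) + f (· - δ)`, with distinct eigenvalues when `δ` is small, hence independent. -/
theorem eq_zero_of_sum_mul_sin_eq_zero {n : ℕ} {t : Fin n → ℝ} (ht : ∀ i, 0 < t i)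
    (hinj : Function.Injective t) {x : Fin n → ℝ}
    (h : ∀ θ, 0 < θ → ∑ i, x i * Real.sin (t i * θ) = 0) : x = 0 := by
  have hall : ∀ θ, ∑ i, x i * Real.sin (t i * θ) = 0 := by
    intro θ
    rcases lt_trichotomy θ 0 with hθ | rfl | hθ
    · have := h (-θ) (by linarith)
      simpa using this
    · simp
    · exact h θ hθ
  -- With the step `δ`, all `t i * δ` lie in `(0, π)`, where the cosine is injective.
  obtain ⟨δ, hδ, hδπ⟩ : ∃ δ : ℝ, 0 < δ ∧ ∀ i, t i * δ < Real.pi := by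
    have hS : 0 < 1 + ∑ i, t i := by
      have := Finset.sum_nonneg fun i (_ : i ∈ Finset.univ) ↦ (ht i).le
      linarith
    refine ⟨Real.pi / (1 + ∑ i, t i), by positivity, fun i ↦ ?_⟩
    have := Finset.single_le_sum (fun i _ ↦ (ht i).le) (Finset.mem_univ i)
    rw [← mul_div_assoc, div_lt_iff₀ hS, mul_comm]
    exact mul_lt_mul_of_pos_left (by linarith) Real.pi_pos
  let T : Module.End ℝ (ℝ → ℝ) :=
    { toFun := fun f θ ↦ f (θ + δ) + f (θ - δ)
      map_add' := fun f g ↦ by ext θ; simp; ring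
      map_smul' := fun c f ↦ by ext θ; simp; ring }
  have hlin : LinearIndependent ℝ fun i θ ↦ Real.sin (t i * θ) := by
    refine T.eigenvectors_linearIndependent' (fun i ↦ 2 * Real.cos (t i * δ)) ?_ _ fun i ↦ ?_
    · intro i j hij
      have := Real.injOn_cos ⟨by have := ht i; positivity, (hδπ i).le⟩
        ⟨by have := ht j; positivity, (hδπ j).le⟩ (mul_left_cancel₀ two_ne_zero hij)
      exact hinj (mul_right_cancel₀ hδ.ne' this)
    · refine ⟨Module.End.mem_eigenspace_iff.2 ?_, fun h0 ↦ ?_⟩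
      · ext θ
        simp only [T, LinearMap.coe_mk, AddHom.coe_mk, Pi.smul_apply, smul_eq_mul, mul_add,
          mul_sub, Real.sin_add, Real.sin_sub]
        ring
      · exact (Real.sin_pos_of_pos_of_lt_pi (mul_pos (ht i) hδ) (hδπ i)).ne' (congrFun h0 δ)
  refine funext <| Fintype.linearIndependent_iff.1 hlin x ?_
  ext θ
  simpa using hall θ

/-- Differentiation reduces this to the independence of sines. -/
theorem eq_zero_of_sum_mul_one_sub_cos_eq_zero {n : ℕ} {t : Fin n → ℝ} (ht : ∀ i, 0 < t i)
    (hinj : Function.Injective t) {x : Fin n → ℝ}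
    (h : ∀ θ, 0 < θ → ∑ i, x i * (1 - Real.cos (t i * θ)) = 0) : x = 0 := by
  have hd : (fun i ↦ x i * t i) = 0 := by
    refine eq_zero_of_sum_mul_sin_eq_zero ht hinj fun θ hθ ↦ ?_
    have h1 : HasDerivAt (fun θ ↦ ∑ i, x i * (1 - Real.cos (t i * θ)))
        (∑ i, x i * t i * Real.sin (t i * θ)) θ := by
      refine HasDerivAt.fun_sum fun i _ ↦ ?_
      exact (((hasDerivAt_const_mul (t i)).cos.const_sub 1).const_mul (x i)).congr_deriv
        (by ring)
    have h2 : HasDerivAt (fun θ ↦ ∑ i, x i * (1 - Real.cos (t i * θ))) 0 θ :=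
      (hasDerivAt_const θ 0).congr_of_eventuallyEq <|
        Filter.eventually_of_mem (Ioi_mem_nhds hθ) h
    exact h1.unique h2
  exact funext fun i ↦ by simpa [(ht i).ne'] using congrFun hd i

theorem eq_zero_of_sum_mul_one_sub_exp_eq_zero {n : ℕ} {t : Fin n → ℝ} (ht : ∀ i, 0 < t i)
    (hinj : Function.Injective t) {x : Fin n → ℝ}
    (h : ∀ θ, 0 < θ → ∑ i, x i * (1 - Real.exp (-(t i * θ))) = 0) : x = 0 := by
  have hall : ∀ k : ℕ, ∑ i, x i * (1 - Real.exp (-t i) ^ k) = 0 := by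
    intro k
    rcases k.eq_zero_or_pos with rfl | hk
    · simp
    · simpa [← Real.exp_nat_mul, mul_comm] using h k (by exact_mod_cast hk)
  -- Differences of consecutive values give a Vandermonde system.
  have hd : (fun i ↦ x i * (1 - Real.exp (-t i))) = 0 := by
    refine Matrix.eq_zero_of_forall_pow_sum_mul_pow_eq_zero (f := fun i ↦ Real.exp (-t i))
      (fun i j hij ↦ hinj (neg_injective (Real.exp_injective hij))) fun k ↦ ?_
    have := congrArg₂ (· - ·) (hall (k + 1)) (hall k)
    simp only [← Finset.sum_sub_distrib, sub_self] at this
    rw [← this]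
    exact Finset.sum_congr rfl fun i _ ↦ by ring
  refine funext fun i ↦ ?_
  have h1 : 1 - Real.exp (-t i) ≠ 0 :=
    (sub_pos.2 (Real.exp_lt_one_iff.2 (neg_lt_zero.2 (ht i)))).ne'
  simpa [h1] using congrFun hd i

/-! ### Integral representations of powers -/

/-- `HasPowerIntegral α f r` says that `f` is integrable on `(0, ∞)` with respect to the measure
`θ ^ (-1 - α) dθ`, with integral `r`. -/
def HasPowerIntegral (α : ℝ) (f : ℝ → ℝ) (r : ℝ) : Prop :=
  IntegrableOn (fun θ ↦ f θ * θ ^ (-1 - α)) (Ioi 0) ∧ ∫ θ in Ioi 0, f θ * θ ^ (-1 - α) = r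

namespace HasPowerIntegral

variable {α : ℝ} {f g : ℝ → ℝ} {a b : ℝ}

theorem congr (h : HasPowerIntegral α f a)
    (hfg : ∀ θ, f θ = g θ) (hab : a = b) : HasPowerIntegral α g b := by
  rwa [← hab, ← funext hfg]

theorem add (hf : HasPowerIntegral α f a) (hg : HasPowerIntegral α g b) :
    HasPowerIntegral α (fun θ ↦ f θ + g θ) (a + b) := by
  refine ⟨(hf.1.add hg.1).congr_fun (fun θ _ ↦ (add_mul _ _ _).symm) measurableSet_Ioi, ?_⟩
  simp only [add_mul]
  rw [integral_add hf.1 hg.1, hf.2, hg.2]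

theorem sub (hf : HasPowerIntegral α f a) (hg : HasPowerIntegral α g b) :
    HasPowerIntegral α (fun θ ↦ f θ - g θ) (a - b) := by
  refine ⟨(hf.1.sub hg.1).congr_fun (fun θ _ ↦ (sub_mul _ _ _).symm) measurableSet_Ioi, ?_⟩
  simp only [sub_mul]
  rw [integral_sub hf.1 hg.1, hf.2, hg.2]

theorem const_mul (c : ℝ) (hf : HasPowerIntegral α f a) :
    HasPowerIntegral α (fun θ ↦ c * f θ) (c * a) := by
  refine ⟨IntegrableOn.congr_fun (hf.1.const_mul c)
    (fun θ _ ↦ (mul_assoc _ _ _).symm) measurableSet_Ioi, ?_⟩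
  simp only [mul_assoc]
  rw [integral_const_mul, hf.2]

/-- A function vanishing at `0` integrates, after rescaling by `x ≥ 0`, to a multiple of
`x ^ α`. -/
theorem comp_mul (hf : HasPowerIntegral α f a) (hα : α ≠ 0) (h0 : f 0 = 0) {x : ℝ} (hx : 0 ≤ x) :
    HasPowerIntegral α (fun θ ↦ f (x * θ)) (a * x ^ α) := by
  rcases hx.eq_or_lt with rfl | hx
  · simp [HasPowerIntegral, h0, hα]
  have key : EqOn (fun θ ↦ f (x * θ) * θ ^ (-1 - α))
      (fun θ ↦ x ^ (1 + α) * (f (x * θ) * (x * θ) ^ (-1 - α))) (Ioi 0) := by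
    intro θ hθ
    have hθ : 0 < θ := hθ
    have : x ^ (1 + α) * x ^ (-1 - α) = 1 := by
      rw [← Real.rpow_add hx]; simp
    simp only [Real.mul_rpow hx.le hθ.le]
    linear_combination (-(f (x * θ) * θ ^ (-1 - α))) * this
  constructor
  · refine IntegrableOn.congr_fun (Integrable.const_mul ?_ _) key.symm measurableSet_Ioi
    exact (integrableOn_Ioi_comp_mul_left_iff (fun θ ↦ f θ * θ ^ (-1 - α)) 0 hx).2
      (by simpa using hf.1)
  · rw [setIntegral_congr_fun measurableSet_Ioi key, integral_const_mul,
      integral_comp_mul_left_Ioi (fun θ ↦ f θ * θ ^ (-1 - α)) 0 hx, mul_zero, hf.2,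
      Real.rpow_add hx, smul_eq_mul, Real.rpow_one]
    field_simp

/-- Existence of the integral, from power bounds with exponents `p > α` near `0` and `q < α` near
infinity; positivity holds when the function is positive on `(0, 1)`. -/
theorem exists_pos (hf : Continuous f) {p q A : ℝ} (hp : α < p) (hq : q < α)
    (hfp : ∀ θ, 0 < θ → θ ≤ 1 → f θ ≤ θ ^ p) (hfq : ∀ θ, 1 < θ → f θ ≤ A * θ ^ q)
    (hnn : ∀ θ, 0 < θ → 0 ≤ f θ) (hpos : ∀ θ, 0 < θ → θ < 1 → 0 < f θ) :
    ∃ c, 0 < c ∧ HasPowerIntegral α f c := by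
  have hcont : ContinuousOn (fun θ ↦ f θ * θ ^ (-1 - α)) (Ioi 0) :=
    hf.continuousOn.mul fun θ (hθ : 0 < θ) ↦
      (Real.continuousAt_rpow_const _ _ (.inl hθ.ne')).continuousWithinAt
  have hint : IntegrableOn (fun θ ↦ f θ * θ ^ (-1 - α)) (Ioi 0) := by
    rw [← Ioc_union_Ioi_eq_Ioi zero_le_one, integrableOn_union]
    constructor
    · have hb : IntegrableOn (fun θ : ℝ ↦ θ ^ (p - 1 - α)) (Ioc 0 1) :=
        (intervalIntegrable_iff_integrableOn_Ioc_of_le zero_le_one).1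
          (intervalIntegral.intervalIntegrable_rpow' (by linarith))
      refine Integrable.mono' hb
        ((hcont.mono fun θ hθ ↦ hθ.1).aestronglyMeasurable measurableSet_Ioc) ?_
      refine (ae_restrict_iff' measurableSet_Ioc).2 (.of_forall fun θ hθ ↦ ?_)
      have h1 : (0 : ℝ) < θ ^ (-1 - α) := Real.rpow_pos_of_pos hθ.1 _
      rw [Real.norm_of_nonneg (mul_nonneg (hnn θ hθ.1) h1.le),
        show p - 1 - α = p + (-1 - α) by ring, Real.rpow_add hθ.1]
      exact mul_le_mul_of_nonneg_right (hfp θ hθ.1 hθ.2) h1.le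
    · have hb : IntegrableOn (fun θ : ℝ ↦ A * θ ^ (q - 1 - α)) (Ioi 1) :=
        (integrableOn_Ioi_rpow_of_lt (by linarith) one_pos).const_mul A
      refine Integrable.mono' hb
        ((hcont.mono (Ioi_subset_Ioi zero_le_one)).aestronglyMeasurable measurableSet_Ioi) ?_
      refine (ae_restrict_iff' measurableSet_Ioi).2 (.of_forall fun θ (hθ : 1 < θ) ↦ ?_)
      have h0 : 0 < θ := by linarith
      have h1 : (0 : ℝ) < θ ^ (-1 - α) := Real.rpow_pos_of_pos h0 _
      rw [Real.norm_of_nonneg (mul_nonneg (hnn θ h0) h1.le),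
        show q - 1 - α = q + (-1 - α) by ring, Real.rpow_add h0, ← mul_assoc]
      exact mul_le_mul_of_nonneg_right (hfq θ hθ) h1.le
  refine ⟨_, ?_, hint, rfl⟩
  rw [setIntegral_pos_iff_support_of_nonneg_ae _ hint]
  · refine lt_of_lt_of_le ?_ (measure_mono (s := Ioo (0 : ℝ) 1) fun θ hθ ↦ ⟨?_, hθ.1⟩)
    · simp
    · exact (mul_pos (hpos θ hθ.1 hθ.2) (Real.rpow_pos_of_pos hθ.1 _)).ne'
  · refine (ae_restrict_iff' measurableSet_Ioi).2 (.of_forall fun θ (hθ : 0 < θ) ↦ ?_)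
    exact mul_nonneg (hnn θ hθ) (Real.rpow_nonneg hθ.le _)

theorem exists_one_sub_exp (h0 : 0 < α) (h1 : α < 1) :
    ∃ c, 0 < c ∧ HasPowerIntegral α (fun θ ↦ 1 - Real.exp (-θ)) c := by
  have hlt : ∀ θ : ℝ, 0 < θ → Real.exp (-θ) < 1 := fun θ hθ ↦ Real.exp_lt_one_iff.2 (by linarith)
  refine exists_pos (p := 1) (q := 0) (A := 1) (by fun_prop) h1 h0 (fun θ _ _ ↦ ?_) (fun θ _ ↦ ?_)
    (fun θ hθ ↦ ?_) (fun θ hθ _ ↦ ?_)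
  · rw [Real.rpow_one]
    linarith [Real.add_one_le_exp (-θ)]
  · simpa using (Real.exp_pos (-θ)).le
  · linarith [hlt θ hθ]
  · linarith [hlt θ hθ]

theorem exists_exp_sub_one_add (h1 : 1 < α) (h2 : α < 2) :
    ∃ c, 0 < c ∧ HasPowerIntegral α (fun θ ↦ Real.exp (-θ) - 1 + θ) c := by
  have hlt : ∀ θ : ℝ, 0 < θ → 0 < Real.exp (-θ) - 1 + θ := fun θ hθ ↦ by
    linarith [Real.add_one_lt_exp (neg_ne_zero.2 hθ.ne')]
  refine exists_pos (p := 2) (q := 1) (A := 1) (by fun_prop) h2 h1 (fun θ h0 hθ ↦ ?_)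
    (fun θ hθ ↦ ?_) (fun θ hθ ↦ (hlt θ hθ).le) (fun θ hθ _ ↦ hlt θ hθ)
  · have := Real.abs_exp_sub_one_sub_id_le (x := -θ) (by rwa [abs_neg, abs_of_pos h0])
    rw [Real.rpow_two]
    linarith [le_abs_self (Real.exp (-θ) - 1 - -θ), neg_sq θ]
  · rw [Real.rpow_one]
    linarith [Real.exp_lt_one_iff.2 (show -θ < 0 by linarith)]

theorem exists_one_sub_cos (h0 : 0 < α) (h2 : α < 2) :
    ∃ c, 0 < c ∧ HasPowerIntegral α (fun θ ↦ 1 - Real.cos θ) c := by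
  refine exists_pos (p := 2) (q := 0) (A := 2) (by fun_prop) h2 h0 (fun θ _ _ ↦ ?_) (fun θ _ ↦ ?_)
    (fun θ _ ↦ ?_) (fun θ hθ hθ1 ↦ ?_)
  · rw [Real.rpow_two]
    linarith [Real.one_sub_sq_div_two_le_cos (x := θ), sq_nonneg θ]
  · rw [Real.rpow_zero]
    linarith [Real.neg_one_le_cos θ]
  · linarith [Real.cos_le_one θ]
  · have := Real.cos_lt_cos_of_nonneg_of_le_pi le_rfl (by linarith [Real.pi_gt_three]) hθ
    rw [Real.cos_zero] at this
    linarith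

/-- A matrix whose positive multiple is a `θ ^ (-1 - α) dθ`-mixture of positive semidefinite
matrices, continuous in `θ`, is positive definite as soon as no nonzero vector is isotropic for all
of them. -/
theorem posDef {ι : Type*} [Fintype ι] {R : Matrix ι ι ℝ} {M : ℝ → Matrix ι ι ℝ} {c : ℝ}
    (hc : 0 < c) (hR : ∀ i j, HasPowerIntegral α (fun θ ↦ M θ i j) (c * R i j))
    (hM : ∀ θ, 0 < θ → (M θ).PosSemidef) (hcont : ∀ i j, Continuous fun θ ↦ M θ i j)
    (hne : ∀ x : ι → ℝ, (∀ θ, 0 < θ → ∑ i, ∑ j, x i * x j * M θ i j = 0) → x = 0) :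
    R.PosDef := by
  have hsymm : ∀ i j, R i j = R j i := fun i j ↦ by
    refine mul_left_cancel₀ hc.ne' ?_
    rw [← (hR i j).2, ← (hR j i).2]
    exact setIntegral_congr_fun measurableSet_Ioi fun θ hθ ↦ by
      simp only [(hM θ hθ).symm_apply i j]
  refine .of_sum_pos hsymm fun x hx ↦ ?_
  have hQ : HasPowerIntegral α (fun θ ↦ ∑ i, ∑ j, x i * x j * M θ i j)
      (c * ∑ i, ∑ j, x i * x j * R i j) := by
    have hi : ∀ i j, IntegrableOn (fun θ ↦ x i * x j * (M θ i j * θ ^ (-1 - α))) (Ioi 0) :=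
      fun i j ↦ (hR i j).1.const_mul _
    have hij : ∀ i, IntegrableOn (fun θ ↦ ∑ j, x i * x j * (M θ i j * θ ^ (-1 - α))) (Ioi 0) :=
      fun i ↦ integrable_finsetSum _ fun j _ ↦ hi i j
    simp only [HasPowerIntegral, Finset.sum_mul, mul_assoc (_ * _) (M _ _ _)]
    refine ⟨integrable_finsetSum _ fun i _ ↦ hij i, ?_⟩
    rw [integral_finsetSum _ fun i _ ↦ hij i, Finset.mul_sum]
    refine Finset.sum_congr rfl fun i _ ↦ ?_
    rw [integral_finsetSum _ fun j _ ↦ hi i j, Finset.mul_sum]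
    refine Finset.sum_congr rfl fun j _ ↦ ?_
    rw [integral_const_mul, (hR i j).2]
    ring
  refine pos_of_mul_pos_right (a := c) ?_ hc.le
  have hnn : 0 ≤ᵐ[volume.restrict (Ioi 0)]
      fun θ ↦ (∑ i, ∑ j, x i * x j * M θ i j) * θ ^ (-1 - α) :=
    (ae_restrict_iff' measurableSet_Ioi).2 <| .of_forall fun θ (hθ : 0 < θ) ↦
      mul_nonneg ((hM θ hθ).sum_nonneg x) (Real.rpow_nonneg hθ.le _)
  rw [← hQ.2]
  refine (integral_nonneg_of_ae hnn).lt_of_ne' fun h0 ↦ hx (hne x fun θ hθ ↦ ?_)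
  have hae := (integral_eq_zero_iff_of_nonneg_ae hnn hQ.1).1 h0
  have hae' : (fun θ ↦ ∑ i, ∑ j, x i * x j * M θ i j) =ᵐ[volume.restrict (Ioi 0)] 0 := by
    filter_upwards [hae, ae_restrict_mem measurableSet_Ioi] with θ h1 (h2 : 0 < θ)
    simpa [(Real.rpow_pos_of_pos h2 _).ne'] using h1
  refine Measure.eqOn_open_of_ae_eq hae' isOpen_Ioi (Continuous.continuousOn ?_)
    continuousOn_const hθ
  exact continuous_finsetSum _ fun i _ ↦ continuous_finsetSum _ fun j _ ↦
    (hcont i j).const_mul _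

/-- The rank-one case of `HasPowerIntegral.posDef`. -/
theorem posDef_of_rank_one {ι : Type*} [Fintype ι] {R : Matrix ι ι ℝ} {v : ι → ℝ → ℝ} {c : ℝ}
    (hc : 0 < c) (hR : ∀ i j, HasPowerIntegral α (fun θ ↦ v i θ * v j θ) (c * R i j))
    (hcont : ∀ i, Continuous (v i))
    (hne : ∀ x : ι → ℝ, (∀ θ, 0 < θ → ∑ i, x i * v i θ = 0) → x = 0) : R.PosDef := by
  have hsq : ∀ (x : ι → ℝ) (θ : ℝ),
      ∑ i, ∑ j, x i * x j * (v i θ * v j θ) = (∑ i, x i * v i θ) ^ 2 := fun x θ ↦ by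
    rw [sq, Finset.sum_mul_sum]
    exact Finset.sum_congr rfl fun i _ ↦ Finset.sum_congr rfl fun j _ ↦ by ring
  refine posDef (M := fun θ ↦ Matrix.of fun i j ↦ v i θ * v j θ) hc hR (fun θ _ ↦ ?_)
    (fun i j ↦ (hcont i).mul (hcont j)) fun x hx ↦ hne x fun θ hθ ↦ ?_
  · refine .of_sum_nonneg (fun i j ↦ mul_comm _ _) fun x ↦ ?_
    simp only [Matrix.of_apply, hsq]
    positivity
  · have := hx θ hθ
    simp only [Matrix.of_apply, hsq] at this
    exact pow_eq_zero_iff two_ne_zero |>.1 this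

/-- The case of `HasPowerIntegral.posDef` in which every matrix is itself positive definite. -/
theorem posDef_of_forall_posDef {ι : Type*} [Fintype ι] {R : Matrix ι ι ℝ}
    {M : ℝ → Matrix ι ι ℝ} {c : ℝ} (hc : 0 < c)
    (hR : ∀ i j, HasPowerIntegral α (fun θ ↦ M θ i j) (c * R i j))
    (hM : ∀ θ, 0 < θ → (M θ).PosDef) (hcont : ∀ i j, Continuous fun θ ↦ M θ i j) : R.PosDef := by
  refine posDef hc hR (fun θ hθ ↦ (hM θ hθ).posSemidef) hcont fun x hx ↦ ?_
  by_contra hne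
  exact ((hM 1 one_pos).sum_pos hne).ne' (hx 1 one_pos)

end HasPowerIntegral

/-! ### Strictly positive definite kernels -/

namespace StrictlyPosDefKernel

variable {k l : ℝ → ℝ → ℝ}

theorem congr (hk : StrictlyPosDefKernel k) (h : ∀ s t, 0 < s → 0 < t → k s t = l s t) :
    StrictlyPosDefKernel l := by
  intro n t ht hmono
  convert hk n t ht hmono using 1
  ext i j
  exact (h _ _ (ht i) (ht j)).symm

theorem add (hk : StrictlyPosDefKernel k) (hl : StrictlyPosDefKernel l) :
    StrictlyPosDefKernel fun s t ↦ k s t + l s t :=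
  fun n t ht hmono ↦ (hk n t ht hmono).add (hl n t ht hmono)

theorem const_mul (hk : StrictlyPosDefKernel k) {c : ℝ} (hc : 0 < c) :
    StrictlyPosDefKernel fun s t ↦ c * k s t :=
  fun n t ht hmono ↦ (hk n t ht hmono).smul hc

theorem comp (hk : StrictlyPosDefKernel k) {u : ℝ → ℝ} (hu : ∀ t, 0 < t → 0 < u t)
    (hmono : ∀ s t, 0 < s → s < t → u s < u t) :
    StrictlyPosDefKernel fun s t ↦ k (u s) (u t) :=
  fun n t ht hm ↦ hk n (fun i ↦ u (t i)) (fun i ↦ hu _ (ht i))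
    fun i _ hij ↦ hmono _ _ (ht i) (hm hij)

theorem comp_rpow (hk : StrictlyPosDefKernel k) {a : ℝ} (ha : 0 < a) :
    StrictlyPosDefKernel fun s t ↦ k (s ^ a) (t ^ a) :=
  hk.comp (fun _ ht ↦ Real.rpow_pos_of_pos ht _)
    fun _ _ hs hst ↦ Real.rpow_lt_rpow hs.le hst ha

theorem mul_weight (hk : StrictlyPosDefKernel k) {d : ℝ → ℝ} (hd : ∀ t, 0 < d t) :
    StrictlyPosDefKernel fun s t ↦ d s * d t * k s t :=
  fun n t ht hmono ↦ (hk n t ht hmono).diagonal_congr fun i ↦ hd (t i)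

theorem exp_sub_one (hk : StrictlyPosDefKernel k) :
    StrictlyPosDefKernel fun s t ↦ Real.exp (k s t) - 1 :=
  fun n t ht hmono ↦ (hk n t ht hmono).map_exp_sub_one

/-- If `S` and `D` are strictly positive definite, so is the mean of `exp (S + D)` and
`exp (S - D)`, less `1`: it equals `(exp S - 1) + exp S * (cosh D - 1)`. -/
theorem exp_mul_cosh_sub_one (hk : StrictlyPosDefKernel k) (hl : StrictlyPosDefKernel l) :
    StrictlyPosDefKernel fun s t ↦ Real.exp (k s t) * Real.cosh (l s t) - 1 := by
  intro n t ht hmono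
  have hA := hk n t ht hmono
  have hB := hl n t ht hmono
  convert hA.map_exp_sub_one.add_posSemidef
    (hA.posSemidef.map_exp.hadamard (𝕜 := ℝ) hB.posSemidef.map_cosh_sub_one) using 1
  ext i j
  simp
  ring

theorem of_rank_one {α c : ℝ} {g : ℝ → ℝ} (hc : 0 < c) (hg : Continuous g)
    (hk : ∀ s t, 0 < s → 0 < t →
      HasPowerIntegral α (fun θ ↦ g (s * θ) * g (t * θ)) (c * k s t))
    (hne : ∀ {n : ℕ} {t : Fin n → ℝ}, (∀ i, 0 < t i) → Function.Injective t → ∀ {x : Fin n → ℝ},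
      (∀ θ, 0 < θ → ∑ i, x i * g (t i * θ) = 0) → x = 0) : StrictlyPosDefKernel k :=
  fun _ t ht hmono ↦ HasPowerIntegral.posDef_of_rank_one (v := fun i θ ↦ g (t i * θ)) hc
    (fun i j ↦ hk _ _ (ht i) (ht j)) (fun i ↦ by fun_prop) fun _ hx ↦ hne ht hmono.injective hx

theorem of_mixture {α c : ℝ} {m : ℝ → ℝ → ℝ → ℝ} (hc : 0 < c)
    (hm : ∀ θ, 0 < θ → StrictlyPosDefKernel (m θ)) (hcont : ∀ s t, Continuous fun θ ↦ m θ s t)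
    (hk : ∀ s t, 0 < s → 0 < t → HasPowerIntegral α (fun θ ↦ m θ s t) (c * k s t)) :
    StrictlyPosDefKernel k :=
  fun n t ht hmono ↦ HasPowerIntegral.posDef_of_forall_posDef
    (M := fun θ ↦ Matrix.of fun i j ↦ m θ (t i) (t j)) hc
    (fun i j ↦ hk _ _ (ht i) (ht j)) (fun θ hθ ↦ hm θ hθ n t ht hmono) fun _ _ ↦ hcont _ _

end StrictlyPosDefKernel

/-! ### Kernels with a rank-one integral representation -/

/-- Up to a positive factor, the kernel is the integral of `sin (s θ) * sin (t θ)`. -/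
theorem strictlyPosDefKernel_oddFbmCov {H : ℝ} (h0 : 0 < H) (h1 : H < 1) :
    StrictlyPosDefKernel (oddFbmCov H) := by
  obtain ⟨c, hc, hcos⟩ := HasPowerIntegral.exists_one_sub_cos (α := 2 * H)
    (by linarith) (by linarith)
  have hΦ := fun (x : ℝ) (hx : 0 ≤ x) ↦ hcos.comp_mul (by positivity) (by simp) hx
  refine .of_rank_one (α := 2 * H) (g := Real.sin) (half_pos hc) Real.continuous_sin (fun s t hs ht ↦ ?_)
    eq_zero_of_sum_mul_sin_eq_zero
  refine (((hΦ (t + s) (by positivity)).sub (hΦ |t - s| (abs_nonneg _))).const_mul (1 / 2)).congr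
    (fun θ ↦ ?_) (by rw [oddFbmCov]; ring)
  have habs : Real.cos (|t - s| * θ) = Real.cos ((t - s) * θ) := by
    rcases abs_cases (t - s) with ⟨h, -⟩ | ⟨h, -⟩ <;> rw [h]
    rw [neg_mul, Real.cos_neg]
  rw [habs, add_mul, sub_mul, Real.cos_add, Real.cos_sub]
  ring

/-- Up to a positive factor, the kernel is the integral of
`(1 - cos (s θ)) * (1 - cos (t θ))`. -/
theorem strictlyPosDefKernel_subFbmCov {H : ℝ} (h0 : 0 < H) (h1 : H < 1) :
    StrictlyPosDefKernel (subFbmCov H) := by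
  obtain ⟨c, hc, hcos⟩ := HasPowerIntegral.exists_one_sub_cos (α := 2 * H)
    (by linarith) (by linarith)
  have hΦ := fun (x : ℝ) (hx : 0 ≤ x) ↦ hcos.comp_mul (by positivity) (by simp) hx
  refine .of_rank_one (α := 2 * H) (g := fun y ↦ 1 - Real.cos y) hc (by fun_prop) (fun s t hs ht ↦ ?_)
    eq_zero_of_sum_mul_one_sub_cos_eq_zero
  refine (((hΦ t ht.le).add (hΦ s hs.le)).sub
    (((hΦ (t + s) (by positivity)).add (hΦ |s - t| (abs_nonneg _))).const_mul (1 / 2))).congr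
    (fun θ ↦ ?_) (by rw [subFbmCov]; ring)
  have habs : Real.cos (|s - t| * θ) = Real.cos ((s - t) * θ) := by
    rcases abs_cases (s - t) with ⟨h, -⟩ | ⟨h, -⟩ <;> rw [h]
    rw [neg_mul, Real.cos_neg]
  rw [habs, add_mul, sub_mul, Real.cos_add, Real.cos_sub]
  ring

/-- A two-sided fractional Brownian motion is the sum of its independent even and odd parts, whose
covariances are `subFbmCov H / 2` and `oddFbmCov H / 4`. -/
theorem strictlyPosDefKernel_fbmCov {H : ℝ} (h0 : 0 < H) (h1 : H < 1) :
    StrictlyPosDefKernel (fbmCov H) := by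
  refine (((strictlyPosDefKernel_subFbmCov h0 h1).const_mul one_half_pos).add
    ((strictlyPosDefKernel_oddFbmCov h0 h1).const_mul (c := 1 / 4) (by norm_num))).congr
    fun s t _ _ ↦ ?_
  rw [subFbmCov, oddFbmCov, fbmCov, abs_sub_comm s t, add_comm t s]
  ring

/-- The minimum is the covariance of Brownian motion, that is, of fractional Brownian motion with
Hurst index `1 / 2`. -/
theorem strictlyPosDefKernel_min : StrictlyPosDefKernel min := by
  refine (strictlyPosDefKernel_fbmCov (H := 1 / 2) (by norm_num) (by norm_num)).congr
    fun s t _ _ ↦ ?_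
  rw [fbmCov, mul_one_div_cancel two_ne_zero, Real.rpow_one, Real.rpow_one, Real.rpow_one]
  rcases le_total s t with h | h
  · rw [min_eq_left h, abs_of_nonneg (sub_nonneg.2 h)]
    ring
  · rw [min_eq_right h, abs_of_nonpos (sub_nonpos.2 h)]
    ring

/-- Up to a positive factor, the kernel is the integral of
`(1 - exp (-s θ)) * (1 - exp (-t θ))` against `θ ^ (-1 - K) dθ`. -/
theorem strictlyPosDefKernel_add_sub_rpow_add {K : ℝ} (h0 : 0 < K) (h1 : K < 1) :
    StrictlyPosDefKernel fun s t ↦ s ^ K + t ^ K - (s + t) ^ K := by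
  obtain ⟨c, hc, hexp⟩ := HasPowerIntegral.exists_one_sub_exp h0 h1
  have hΦ := fun (x : ℝ) (hx : 0 ≤ x) ↦ hexp.comp_mul h0.ne' (by simp) hx
  refine .of_rank_one (α := K) (g := fun y ↦ 1 - Real.exp (-y)) hc (by fun_prop)
    (fun s t hs ht ↦ ?_) eq_zero_of_sum_mul_one_sub_exp_eq_zero
  refine (((hΦ s hs.le).add (hΦ t ht.le)).sub (hΦ (s + t) (by positivity))).congr
    (fun θ ↦ ?_) (by ring)
  rw [add_mul, neg_add, Real.exp_add]
  ring

/-- The integrand `(1 - exp (-s θ)) * (1 - exp (-t θ))` still has an integral for `1 < K < 2`; the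
representation of `x ^ K` now comes from `exp (-θ) - 1 + θ`, which reverses the sign. -/
theorem strictlyPosDefKernel_rpow_add_sub_add {K : ℝ} (h1 : 1 < K) (h2 : K < 2) :
    StrictlyPosDefKernel fun s t ↦ (s + t) ^ K - s ^ K - t ^ K := by
  obtain ⟨c, hc, hexp⟩ := HasPowerIntegral.exists_exp_sub_one_add h1 h2
  have hΦ := fun (x : ℝ) (hx : 0 ≤ x) ↦ hexp.comp_mul (by positivity) (by simp) hx
  refine .of_rank_one (α := K) (g := fun y ↦ 1 - Real.exp (-y)) hc (by fun_prop)
    (fun s t hs ht ↦ ?_) eq_zero_of_sum_mul_one_sub_exp_eq_zero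
  refine (((hΦ (s + t) (by positivity)).sub (hΦ s hs.le)).sub (hΦ t ht.le)).congr
    (fun θ ↦ ?_) (by ring)
  rw [add_mul, neg_add, Real.exp_add]
  ring

theorem strictlyPosDefKernel_leiNualartCov' {H K : ℝ} (hH : 0 < H) (h0 : 0 < K) (h1 : K < 1) :
    StrictlyPosDefKernel (leiNualartCov' H K) := by
  have hΓ := Real.Gamma_pos_of_pos (sub_pos.2 h1)
  refine (((strictlyPosDefKernel_add_sub_rpow_add h0 h1).comp_rpow (a := 2 * H)
    (by positivity)).const_mul (c := Real.Gamma (1 - K) / K) (by positivity)).congr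
    fun s t hs ht ↦ ?_
  rw [leiNualartCov', Real.rpow_mul hs.le (2 * H) K, Real.rpow_mul ht.le (2 * H) K]

theorem strictlyPosDefKernel_leiNualartCov {H K : ℝ} (hH : 0 < H) (h0 : 0 < K) (h2 : K < 2)
    (hK : K ≠ 1) : StrictlyPosDefKernel (leiNualartCov H K) := by
  have h2' : 0 < 2 - K := sub_pos.2 h2
  rcases hK.lt_or_gt with h1 | h1
  · refine ((strictlyPosDefKernel_leiNualartCov' hH h0 h1).const_mul (inv_pos.2 h2')).congr
      fun s t _ _ ↦ ?_
    rw [leiNualartCov, leiNualartCov', if_pos h1]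
    field_simp
  · have hΓ := Real.Gamma_pos_of_pos h2'
    have h1' : 0 < K - 1 := sub_pos.2 h1
    refine (((strictlyPosDefKernel_rpow_add_sub_add h1 h2).comp_rpow (a := 2 * H)
      (by positivity)).const_mul (c := Real.Gamma (2 - K) / (K * (K - 1))) (by positivity)).congr
      fun s t hs ht ↦ ?_
    rw [leiNualartCov, if_neg h1.not_gt, Real.rpow_mul hs.le (2 * H) K, Real.rpow_mul ht.le (2 * H) K]

theorem strictlyPosDefKernel_mixedCov {H K : ℝ} (h0 : 0 < H) (h1 : H < 1 / 2) (hK0 : 0 < K)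
    (hK1 : K < 1) : StrictlyPosDefKernel (mixedCov H K) := by
  refine (((strictlyPosDefKernel_add_sub_rpow_add (K := 2 * H) (by positivity)
    (by linarith)).const_mul (half_pos hK0)).add
    ((strictlyPosDefKernel_fbmCov h0 (by linarith)).const_mul (sub_pos.2 hK1))).congr
    fun s t _ _ ↦ ?_
  rw [mixedCov, fbmCov, abs_sub_comm]
  ring

/-! ### Mixtures of strictly positive definite kernels -/

/-- Up to a positive factor, the kernel is the integral of
`exp (-max s t θ) - exp (-(s + t) θ) = exp (-s θ) * exp (-t θ) * (exp (min s t θ) - 1)`, and the last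
factor is `min (u s) (u t)` for the increasing function `u x = exp (x θ) - 1`. -/
theorem strictlyPosDefKernel_sumMaxCov {H : ℝ} (h0 : 0 < H) (h1 : H < 1 / 2) :
    StrictlyPosDefKernel (sumMaxCov H) := by
  obtain ⟨c, hc, hexp⟩ := HasPowerIntegral.exists_one_sub_exp (α := 2 * H)
    (by linarith) (by linarith)
  have hΦ := fun (x : ℝ) (hx : 0 ≤ x) ↦ hexp.comp_mul (by positivity) (by simp) hx
  refine .of_mixture (α := 2 * H) (m := fun θ s t ↦ Real.exp (-(s * θ)) * Real.exp (-(t * θ)) *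
    (Real.exp (min s t * θ) - 1)) hc (fun θ hθ ↦ ?_) (fun s t ↦ by fun_prop) fun s t hs ht ↦ ?_
  · have hu : StrictMono fun x : ℝ ↦ Real.exp (x * θ) - 1 := fun x y hxy ↦
      sub_lt_sub_right (Real.exp_lt_exp.2 (mul_lt_mul_of_pos_right hxy hθ)) 1
    refine ((strictlyPosDefKernel_min.comp (u := fun x ↦ Real.exp (x * θ) - 1) (fun t ht ↦ ?_)
      fun s t _ hst ↦ hu hst).mul_weight (d := fun t ↦ Real.exp (-(t * θ)))
      fun t ↦ Real.exp_pos _).congr fun s t _ _ ↦ ?_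
    · simpa using hu ht
    · rw [← hu.monotone.map_min]
  · refine ((hΦ (s + t) (by positivity)).sub (hΦ (max s t) (hs.le.trans (le_max_left s t)))).congr
      (fun θ ↦ ?_) (by rw [sumMaxCov]; ring)
    rw [mul_sub, ← Real.exp_add, ← Real.exp_add, mul_one,
      show max s t = s + t - min s t by linarith [min_add_max s t]]
    ring_nf

/-- Up to a positive factor, the kernel is the integral of `exp (-|t - s| θ) - exp (-max s t θ)`,
which is `exp (-s θ) * exp (-t θ) * u (min s t)` for the increasing function
`u x = exp (x θ) * (exp (x θ) - 1)`, because `|t - s| = s + t - 2 * min s t`. -/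
theorem strictlyPosDefKernel_maxDiffCov {H : ℝ} (h0 : 0 < H) (h1 : H < 1 / 2) :
    StrictlyPosDefKernel (maxDiffCov H) := by
  obtain ⟨c, hc, hexp⟩ := HasPowerIntegral.exists_one_sub_exp (α := 2 * H)
    (by linarith) (by linarith)
  have hΦ := fun (x : ℝ) (hx : 0 ≤ x) ↦ hexp.comp_mul (by positivity) (by simp) hx
  refine .of_mixture (α := 2 * H) (m := fun θ s t ↦ Real.exp (-(s * θ)) * Real.exp (-(t * θ)) *
    (Real.exp (min s t * θ) * (Real.exp (min s t * θ) - 1))) hc (fun θ hθ ↦ ?_)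
    (fun s t ↦ by fun_prop) fun s t hs ht ↦ ?_
  · have hu : ∀ x y : ℝ, 0 ≤ x → x < y → Real.exp (x * θ) * (Real.exp (x * θ) - 1) <
        Real.exp (y * θ) * (Real.exp (y * θ) - 1) := fun x y hx hxy ↦ by
      have h1 : Real.exp (x * θ) < Real.exp (y * θ) :=
        Real.exp_lt_exp.2 (mul_lt_mul_of_pos_right hxy hθ)
      have h2 : 1 ≤ Real.exp (x * θ) := Real.one_le_exp (by positivity)
      nlinarith
    refine ((strictlyPosDefKernel_min.comp
      (u := fun x ↦ Real.exp (x * θ) * (Real.exp (x * θ) - 1)) (fun t ht ↦ ?_)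
      fun s t hs hst ↦ hu s t hs.le hst).mul_weight (d := fun t ↦ Real.exp (-(t * θ)))
      fun t ↦ Real.exp_pos _).congr fun s t hs ht ↦ ?_
    · simpa using hu 0 t le_rfl ht
    · have hm : MonotoneOn (fun x : ℝ ↦ Real.exp (x * θ) * (Real.exp (x * θ) - 1)) (Ioi 0) :=
        StrictMonoOn.monotoneOn fun x (hx : 0 < x) y _ hxy ↦ hu x y hx.le hxy
      rw [← hm.map_min hs ht]
  · refine ((hΦ (max s t) (hs.le.trans (le_max_left s t))).sub (hΦ |t - s| (abs_nonneg _))).congr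
      (fun θ ↦ ?_) (by rw [maxDiffCov]; ring)
    have habs : |t - s| = s + t - 2 * min s t := by
      linarith [min_add_max s t, max_sub_min_eq_abs s t]
    rw [mul_sub, mul_sub, ← Real.exp_add, ← Real.exp_add, ← Real.exp_add, mul_one,
      ← Real.exp_add, habs, show max s t = s + t - min s t by linarith [min_add_max s t]]
    ring_nf

/-- For `K < 1`, the kernel is a mixture over `θ` of the diagonally rescaled kernels
`exp (2 θ * fbmCov H s t) - 1`. For `K > 1` it is a sum of a Lei–Nualart kernel and the covariance of
a fractional Brownian motion of index `H * K`. -/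
theorem strictlyPosDefKernel_bifbmCov {H K : ℝ} (h0 : 0 < H) (h1 : H < 1) (hK0 : 0 < K)
    (hK2 : K < 2) (hK : K ≠ 1) (hHK : H * K < 1) : StrictlyPosDefKernel (bifbmCov H K) := by
  have h2K : (0 : ℝ) < 1 / 2 ^ K := by positivity
  rcases hK.lt_or_gt with hK1 | hK1
  · obtain ⟨c, hc, hexp⟩ := HasPowerIntegral.exists_one_sub_exp hK0 hK1
    have hΦ := fun (x : ℝ) (hx : 0 ≤ x) ↦ hexp.comp_mul hK0.ne' (by simp) hx
    refine (StrictlyPosDefKernel.of_mixture (α := K)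
      (k := fun s t ↦ (s ^ (2 * H) + t ^ (2 * H)) ^ K - |t - s| ^ (2 * H * K))
      (m := fun θ s t ↦ Real.exp (-(s ^ (2 * H) * θ)) * Real.exp (-(t ^ (2 * H) * θ)) *
        (Real.exp (2 * θ * fbmCov H s t) - 1)) hc (fun θ hθ ↦ ?_) (fun s t ↦ by fun_prop)
      fun s t hs ht ↦ ?_).const_mul h2K |>.congr fun s t _ _ ↦ ?_
    · exact ((strictlyPosDefKernel_fbmCov h0 h1).const_mul (by positivity)).exp_sub_one.mul_weight
        (d := fun t ↦ Real.exp (-(t ^ (2 * H) * θ))) fun t ↦ Real.exp_pos _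
    · refine ((hΦ (s ^ (2 * H) + t ^ (2 * H)) (by positivity)).sub
        (hΦ (|t - s| ^ (2 * H)) (by positivity))).congr (fun θ ↦ ?_) ?_
      · rw [mul_sub, ← Real.exp_add, ← Real.exp_add, fbmCov]
        ring_nf
      · rw [Real.rpow_mul (abs_nonneg _) (2 * H) K]
        ring
    · rw [bifbmCov, abs_sub_comm, add_comm (s ^ (2 * H))]
  · refine ((((strictlyPosDefKernel_rpow_add_sub_add hK1 hK2).comp_rpow (a := 2 * H)
      (by positivity)).add ((strictlyPosDefKernel_fbmCov (H := H * K) (by positivity) hHK).const_mul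
      two_pos)).const_mul h2K).congr fun s t hs ht ↦ ?_
    rw [bifbmCov, fbmCov, abs_sub_comm, ← mul_assoc 2 H K, ← Real.rpow_mul hs.le, ← Real.rpow_mul ht.le]
    ring_nf

/-- For `K < 1`, the kernel is a mixture over `θ` of diagonal rescalings of the mean of `exp (S + D)`
and `exp (S - D)`, less `1`, with `S = θ * subFbmCov H` and `D = θ / 2 * oddFbmCov H`. For `K > 1` it
is a sum of a Lei–Nualart kernel and the covariance of a sub-fractional Brownian motion of index
`H * K`. -/
theorem strictlyPosDefKernel_subBifbmCov {H K : ℝ} (h0 : 0 < H) (h1 : H < 1) (hK0 : 0 < K)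
    (hK2 : K < 2) (hK : K ≠ 1) (hHK : H * K < 1) : StrictlyPosDefKernel (subBifbmCov H K) := by
  rcases hK.lt_or_gt with hK1 | hK1
  · obtain ⟨c, hc, hexp⟩ := HasPowerIntegral.exists_one_sub_exp hK0 hK1
    have hΦ := fun (x : ℝ) (hx : 0 ≤ x) ↦ hexp.comp_mul hK0.ne' (by simp) hx
    refine .of_mixture (α := K)
      (m := fun θ s t ↦ Real.exp (-(s ^ (2 * H) * θ)) * Real.exp (-(t ^ (2 * H) * θ)) *
        (Real.exp (θ * subFbmCov H s t) * Real.cosh (θ / 2 * oddFbmCov H s t) - 1)) hc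
      (fun θ hθ ↦ ?_) (fun s t ↦ by fun_prop) fun s t hs ht ↦ ?_
    · exact (((strictlyPosDefKernel_subFbmCov h0 h1).const_mul hθ).exp_mul_cosh_sub_one
        ((strictlyPosDefKernel_oddFbmCov h0 h1).const_mul (half_pos hθ))).mul_weight
        (d := fun t ↦ Real.exp (-(t ^ (2 * H) * θ))) fun t ↦ Real.exp_pos _
    · refine ((hΦ (s ^ (2 * H) + t ^ (2 * H)) (by positivity)).sub
        (((hΦ ((t + s) ^ (2 * H)) (by positivity)).add
          (hΦ (|t - s| ^ (2 * H)) (by positivity))).const_mul (1 / 2))).congr (fun θ ↦ ?_) ?_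
      · have hplus : Real.exp (-(s ^ (2 * H) * θ)) * Real.exp (-(t ^ (2 * H) * θ)) *
            (Real.exp (θ * subFbmCov H s t) * Real.exp (θ / 2 * oddFbmCov H s t)) =
            Real.exp (-(|t - s| ^ (2 * H) * θ)) := by
          simp only [← Real.exp_add, subFbmCov, oddFbmCov, abs_sub_comm s t]
          ring_nf
        have hminus : Real.exp (-(s ^ (2 * H) * θ)) * Real.exp (-(t ^ (2 * H) * θ)) *
            (Real.exp (θ * subFbmCov H s t) * Real.exp (-(θ / 2 * oddFbmCov H s t))) =
            Real.exp (-((t + s) ^ (2 * H) * θ)) := by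
          simp only [← Real.exp_add, subFbmCov, oddFbmCov, abs_sub_comm s t]
          ring_nf
        rw [Real.cosh_eq, ← hplus, ← hminus, add_mul, neg_add, Real.exp_add]
        ring
      · rw [subBifbmCov, Real.rpow_mul (abs_nonneg _) (2 * H) K,
          Real.rpow_mul (by positivity) (2 * H) K, add_comm t s, abs_sub_comm t s]
        ring_nf
  · refine (((strictlyPosDefKernel_rpow_add_sub_add hK1 hK2).comp_rpow (a := 2 * H)
      (by positivity)).add (strictlyPosDefKernel_subFbmCov (H := H * K) (by positivity) hHK)).congr
      fun s t hs ht ↦ ?_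
    rw [subBifbmCov, subFbmCov, ← mul_assoc 2 H K, ← Real.rpow_mul hs.le, ← Real.rpow_mul ht.le,
      add_comm t s, abs_sub_comm s t]
    ring_nf

/-! ### Passage to Gaussian processes -/

/-- Since `E (G t ^ 2) = R t t`, the second moment bound only concerns the diagonal of `R`, which
is a power by self-similarity. -/
theorem StrictlyPosDefKernel.covarianceSatisfiesHypotheses {R : ℝ → ℝ → ℝ}
    (hR : StrictlyPosDefKernel R) {c β : ℝ} (h0 : 0 < β) (h2 : β < 2)
    (hdiag : ∀ t, 0 ≤ t → R t t = c * t ^ β) : CovarianceSatisfiesHypotheses.{u} R := by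
  refine ⟨hR, fun Ω _ P G hG ↦ ⟨⟨c, β, h0, h2, fun t ↦ ⟨?_, ?_⟩⟩, fun n t ht hmono ↦ ?_⟩⟩
  · exact (hG.gaussian.hasGaussianLaw_eval t).memLp_two.integrable_sq
  · simp only [sq, hG.cov, hdiag _ t.coe_nonneg, le_refl]
  · simp only [hG.cov]
    exact hR n (fun i ↦ t i) ht hmono

theorem rpow_two_mul_add_self_rpow (H K : ℝ) {t : ℝ} (ht : 0 ≤ t) :
    (t ^ (2 * H) + t ^ (2 * H)) ^ K = 2 ^ K * t ^ (2 * H * K) := by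
  rw [← two_mul, Real.mul_rpow two_pos.le (by positivity), Real.rpow_mul ht (2 * H) K]

theorem add_self_rpow (a : ℝ) {t : ℝ} (ht : 0 ≤ t) : (t + t) ^ a = 2 ^ a * t ^ a := by
  rw [← two_mul, Real.mul_rpow two_pos.le ht]

theorem theorem1p1 :
    (∀ H K : ℝ, 0 < H → H < 1 → 0 < K → K < 2 → K ≠ 1 → H * K < 1 →
      CovarianceSatisfiesHypotheses.{u} (leiNualartCov H K)) ∧
    (∀ H K : ℝ, 0 < H → H < 1 → 0 < K → K < 1 →
      CovarianceSatisfiesHypotheses.{u} (leiNualartCov' H K)) ∧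
    (∀ H : ℝ, 0 < H → H < 1 → CovarianceSatisfiesHypotheses.{u} (fbmCov H)) ∧
    (∀ H : ℝ, 0 < H → H < 1 → CovarianceSatisfiesHypotheses.{u} (oddFbmCov H)) ∧
    (∀ H : ℝ, 0 < H → H < 1 → CovarianceSatisfiesHypotheses.{u} (subFbmCov H)) ∧
    (∀ H : ℝ, 0 < H → H < 1 / 2 → CovarianceSatisfiesHypotheses.{u} (sumMaxCov H)) ∧
    (∀ H : ℝ, 0 < H → H < 1 / 2 → CovarianceSatisfiesHypotheses.{u} (maxDiffCov H)) ∧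
    (∀ H K : ℝ, 0 < H → H < 1 / 2 → 0 < K → K < 1 →
      CovarianceSatisfiesHypotheses.{u} (mixedCov H K)) ∧
    (∀ H K : ℝ, 0 < H → H < 1 → 0 < K → K < 2 → K ≠ 1 → H * K < 1 →
      CovarianceSatisfiesHypotheses.{u} (bifbmCov H K)) ∧
    (∀ H K : ℝ, 0 < H → H < 1 → 0 < K → K < 2 → K ≠ 1 → H * K < 1 →
      CovarianceSatisfiesHypotheses.{u} (subBifbmCov H K)) := by
  have h0 : ∀ {a : ℝ}, 0 < a → (0 : ℝ) ^ a = 0 := fun ha ↦ Real.zero_rpow ha.ne'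
  refine ⟨fun H K hH hH1 hK hK2 hK1 hHK ↦ ?_, fun H K hH hH1 hK hK1 ↦ ?_, fun H hH hH1 ↦ ?_,
    fun H hH hH1 ↦ ?_, fun H hH hH1 ↦ ?_, fun H hH hH1 ↦ ?_, fun H hH hH1 ↦ ?_,
    fun H K hH hH1 hK hK1 ↦ ?_, fun H K hH hH1 hK hK2 hK1 hHK ↦ ?_,
    fun H K hH hH1 hK hK2 hK1 hHK ↦ ?_⟩
  · refine (strictlyPosDefKernel_leiNualartCov hH hK hK2 hK1).covarianceSatisfiesHypotheses
      (c := leiNualartCov H K 1 1) (β := 2 * H * K) (by positivity) (by linarith) fun t ht ↦ ?_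
    simp only [leiNualartCov, rpow_two_mul_add_self_rpow H K ht, Real.one_rpow]
    split_ifs <;> ring_nf
  · have hHK : H * K < 1 := mul_lt_one_of_nonneg_of_lt_one_left hH.le hH1 hK1.le
    refine (strictlyPosDefKernel_leiNualartCov' hH hK hK1).covarianceSatisfiesHypotheses
      (c := leiNualartCov' H K 1 1) (β := 2 * H * K) (by positivity) (by linarith) fun t ht ↦ ?_
    simp only [leiNualartCov', rpow_two_mul_add_self_rpow H K ht, Real.one_rpow]
    ring_nf
  · refine (strictlyPosDefKernel_fbmCov hH hH1).covarianceSatisfiesHypotheses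
      (c := 1) (β := 2 * H) (by positivity) (by linarith) fun t ht ↦ ?_
    rw [fbmCov, sub_self, abs_zero, h0 (by positivity)]
    ring
  · refine (strictlyPosDefKernel_oddFbmCov hH hH1).covarianceSatisfiesHypotheses
      (c := 2 ^ (2 * H)) (β := 2 * H) (by positivity) (by linarith) fun t ht ↦ ?_
    rw [oddFbmCov, sub_self, abs_zero, h0 (by positivity), add_self_rpow _ ht, sub_zero]
  · refine (strictlyPosDefKernel_subFbmCov hH hH1).covarianceSatisfiesHypotheses
      (c := 2 - 1 / 2 * 2 ^ (2 * H)) (β := 2 * H) (by positivity) (by linarith) fun t ht ↦ ?_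
    rw [subFbmCov, sub_self, abs_zero, h0 (by positivity), add_self_rpow _ ht]
    ring
  · refine (strictlyPosDefKernel_sumMaxCov hH hH1).covarianceSatisfiesHypotheses
      (c := 2 ^ (2 * H) - 1) (β := 2 * H) (by positivity) (by linarith) fun t ht ↦ ?_
    rw [sumMaxCov, max_self, add_self_rpow _ ht]
    ring
  · refine (strictlyPosDefKernel_maxDiffCov hH hH1).covarianceSatisfiesHypotheses
      (c := 1) (β := 2 * H) (by positivity) (by linarith) fun t ht ↦ ?_
    rw [maxDiffCov, max_self, sub_self, abs_zero, h0 (by positivity)]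
    ring
  · refine (strictlyPosDefKernel_mixedCov hH hH1 hK hK1).covarianceSatisfiesHypotheses
      (c := 1 / 2 * (2 - K * 2 ^ (2 * H))) (β := 2 * H) (by positivity) (by linarith)
      fun t ht ↦ ?_
    rw [mixedCov, sub_self, abs_zero, h0 (by positivity), add_self_rpow _ ht]
    ring
  · refine (strictlyPosDefKernel_bifbmCov hH hH1 hK hK2 hK1 hHK).covarianceSatisfiesHypotheses
      (c := 1) (β := 2 * H * K) (by positivity) (by linarith) fun t ht ↦ ?_
    rw [bifbmCov, sub_self, abs_zero, h0 (by positivity), rpow_two_mul_add_self_rpow _ _ ht]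
    field_simp
    ring
  · refine (strictlyPosDefKernel_subBifbmCov hH hH1 hK hK2 hK1 hHK).covarianceSatisfiesHypotheses
      (c := 2 ^ K - 1 / 2 * 2 ^ (2 * H * K)) (β := 2 * H * K) (by positivity) (by linarith)
      fun t ht ↦ ?_
    rw [subBifbmCov, sub_self, abs_zero, h0 (by positivity), rpow_two_mul_add_self_rpow _ _ ht,
      add_self_rpow _ ht]
    ring
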